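/- Let $R$ be a commutative Noetherian ring which is either local, or graded-local, i.e. $\mathbb{Z}$-graded (for instance $\mathbb{N}$-graded) with a homogeneous maximal ideal that contains every proper homogeneous ideal. Let $I$ be an ideal of $R$, assumed homogeneous in the graded-local case. For $m\ge 0$ let $I^{(m)}=\bigcap_{p\in\mathrm{Ass}(R/I)}(I^mR_p\cap R)$ be the $m$-th symbolic power of $I$ (where $J\cap R$ denotes the preimage of $J$ in $R$), let $R_s(I)=\bigoplus_{m\ge 0}I^{(m)}t^m\subseteq R[t]$ be the symbolic Rees algebra, and let $\mathrm{sdefect}(I,m)=\mu\left(I^{(m)}/I^m\right)$ be the minimal number of generators of the $R$-module $I^{(m)}/I^m$. A function $Q:\mathbb{N}\to\mathbb{Q}$ is a quasi-polynomial with quasi-period $n\ge 1$ if there are polynomials $f_0,\dots,f_{n-1}\in\mathbb{Q}[x]$ such that $Q(m)=f_r(m)$ whenever $m\equiv r \pmod n$ (the quasi-period $n$ need not be minimal). Assume that $R_s(I)$ is a Noetherian ring. Then there is a quasi-polynomial $Q$ such that $\mathrm{sdefect}(I,m)=Q(m)$ for all sufficiently large $m$. Moreover, whenever $R_s(I)$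 is generated as an $R$-algebra by finitely many homogeneous elements (with respect to the grading by powers of $t$) of positive degrees $d_1,\dots,d_s$, the number $\mathrm{lcm}(d_1,\dots,d_s)$ is a quasi-period of $Q$ (the empty lcm being $1$). -/

import Mathlib

open Polynomial

/-- The `n`-th symbolic power of `I`: the intersection, over the associated primes `p` of `I`
(that is, of the module `R ⧸ I`), of the preimages in `R` of `I ^ n` extended to `R_p`. -/
noncomputable def Ideal.symbolicPower {R : Type*} [CommRing R] (I : Ideal R) (n : ℕ) : Ideal R :=
  ⨅ (p : Ideal R) (hp : p ∈ associatedPrimes R (R ⧸ I)),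
    haveI : p.IsPrime := hp.isPrime
    ((I ^ n).map (algebraMap R (Localization.AtPrime p))).comap
      (algebraMap R (Localization.AtPrime p))

theorem Ideal.mem_symbolicPower_iff {R : Type*} [CommRing R] {I : Ideal R} {n : ℕ} {x : R} :
    x ∈ I.symbolicPower n ↔ ∀ (p : Ideal R) (hp : p ∈ associatedPrimes R (R ⧸ I)),
      haveI : p.IsPrime := hp.isPrime
      algebraMap R (Localization.AtPrime p) x ∈
        (I ^ n).map (algebraMap R (Localization.AtPrime p)) := by
  simp only [Ideal.symbolicPower, Submodule.mem_iInf, Ideal.mem_comap]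

theorem Ideal.pow_le_symbolicPower {R : Type*} [CommRing R] (I : Ideal R) (n : ℕ) :
    I ^ n ≤ I.symbolicPower n :=
  fun _ hx => Ideal.mem_symbolicPower_iff.2 fun _ _ => Ideal.mem_map_of_mem _ hx

theorem Ideal.mul_mem_symbolicPower_add {R : Type*} [CommRing R] {I : Ideal R} {j k : ℕ}
    {x y : R} (hx : x ∈ I.symbolicPower j) (hy : y ∈ I.symbolicPower k) :
    x * y ∈ I.symbolicPower (j + k) := by
  rw [Ideal.mem_symbolicPower_iff] at hx hy ⊢
  intro p hp
  rw [pow_add, Ideal.map_mul, map_mul]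
  exact Ideal.mul_mem_mul (hx p hp) (hy p hp)

/-- The symbolic Rees algebra of `I`: the `R`-subalgebra of `R[X]` (the indeterminate `X` playing
the role of `t`) of all polynomials whose `i`-th coefficient lies in `I.symbolicPower i`. -/
noncomputable def symbolicReesAlgebra {R : Type*} [CommRing R] (I : Ideal R) :
    Subalgebra R R[X] where
  carrier := { f | ∀ i, f.coeff i ∈ I.symbolicPower i }
  mul_mem' hf hg i := by
    rw [coeff_mul]
    refine Ideal.sum_mem _ ?_
    rintro ⟨j, k⟩ e
    rw [← Finset.HasAntidiagonal.mem_antidiagonal.mp e]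
    exact Ideal.mul_mem_symbolicPower_add (hf j) (hg k)
  add_mem' hf hg i := by
    rw [coeff_add]
    exact Ideal.add_mem _ (hf i) (hg i)
  algebraMap_mem' r i := by
    rw [Polynomial.algebraMap_apply, coeff_C]
    split_ifs with h
    · subst h
      exact Ideal.pow_le_symbolicPower I 0 (by simp)
    · exact Ideal.zero_mem _

/-- The `m`-th symbolic defect of `I`: the minimal number of generators of the `R`-module
`I.symbolicPower m ⧸ I ^ m`. -/
noncomputable def symbolicDefect {R : Type*} [CommRing R] (I : Ideal R) (m : ℕ) : ℕ :=
  (⊤ : Submodule R (↥(I.symbolicPower m) ⧸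
    Submodule.comap (Submodule.subtype (I.symbolicPower m)) (I ^ m))).spanFinrank

/-- `f` is a quasi-polynomial for which `n` is a (not necessarily least) quasi-period. -/
def HasQuasiPeriod (f : ℕ → ℚ) (n : ℕ) : Prop :=
  0 < n ∧ ∃ P : Fin n → ℚ[X], ∀ (r : Fin n) (m : ℕ), m ≡ r [MOD n] → f m = (P r).eval (m : ℚ)

/-- `f` is a quasi-polynomial. -/
def IsQuasiPolynomial (f : ℕ → ℚ) : Prop :=
  ∃ n : ℕ, HasQuasiPeriod f n

/-- A graded ring is graded-local if it has a homogeneous maximal ideal that contains every proper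
homogeneous ideal. -/
def IsGradedLocal {R : Type*} [CommRing R] (𝒜 : ℤ → AddSubgroup R) [GradedRing 𝒜] : Prop :=
  ∃ 𝔪 : Ideal R, 𝔪.IsMaximal ∧ 𝔪.IsHomogeneous 𝒜 ∧
    ∀ J : Ideal R, J.IsHomogeneous 𝒜 → J ≠ ⊤ → J ≤ 𝔪

/-!
The symbolic defect is written as a difference of two lengths, and each length is counted by the
lattice points of given weighted degree in a lower set of `ℕ ^ s`.

Put `N m = I.symbolicPower m` and let `𝔪` be the (homogeneous) maximal ideal. By Nakayama's lemma
`N m ⧸ I ^ m` needs as many generators as `N m ⧸ (I ^ m + 𝔪 N m)` has length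
(`exists_isMaximal_symbolicDefect_eq_relLength`). In the graded-local case this uses that symbolic
powers of homogeneous ideals are homogeneous. It is enough that `J R_p ∩ R` is homogeneous for `J`
homogeneous and `p` any prime ideal, and this follows because, for every `x`, the radical of the
conductor `J : x` is homogeneous (`Ideal.IsHomogeneous.radical_colon_singleton`).

With `F m = 𝔪 N m`, the symbolic defect is the length of `N m ⧸ F m` minus that of
`(I ^ m + F m) ⧸ F m`. Both `N m` and `I ^ m` are spanned by the monomials of weighted degree `m` in
finitely many elements: in the first case the coefficients of homogeneous algebra generators of the
symbolic Rees algebra, with their degrees as weights, and in the second case generators of `I`, with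
weights `1`. Adding these monomials to `F m` one at a time in lexicographic order, the length grows
by one exactly at the *standard* monomials, those not congruent modulo `F m` to a combination of
smaller ones (`relLength_span_monomials_eq_ncard`). A multiple of a nonstandard monomial is again
nonstandard, so the exponents of standard monomials form a lower set, whose counting function is
eventually a quasi-polynomial (`LowerSet.eventuallyQuasiPolynomial_ncard`) for which every common
multiple of the weights is a quasi-period. This combinatorial count takes the place of the
Hilbert-Serre theorem.

A quasi-polynomial is determined by its values at large arguments
(`HasQuasiPeriod.eq_of_eventuallyEq`), so the same `Q` serves for all systems of generators.
-/

/-! ### Relative lengths and Nakayama's lemma -/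

section Length

variable {R M : Type*} [CommRing R] [AddCommGroup M] [Module R M]

/-- The length of the module `B ⧸ A`, where `A ≤ B` are submodules of an ambient module. -/
noncomputable def Submodule.relLength (A B : Submodule R M) : ℕ∞ :=
  Module.length R (B ⧸ A.submoduleOf B)

namespace Submodule

theorem relLength_add {A B C : Submodule R M} (hAB : A ≤ B) (hBC : B ≤ C) :
    A.relLength C = A.relLength B + B.relLength C := by
  have h₁ : A.submoduleOf B ≤ (A.submoduleOf C).comap (inclusion hBC) := fun _ hx => hx
  have h₂ : A.submoduleOf C ≤ B.submoduleOf C := fun _ hx => hAB hx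
  refine Module.length_eq_add_of_exact (mapQ _ _ (inclusion hBC) h₁) (factor h₂) ?_
    (factor_surjective h₂) ?_
  · rw [← LinearMap.ker_eq_bot, ker_mapQ, eq_bot_iff]
    rintro _ ⟨x, hx, rfl⟩
    exact (Quotient.mk_eq_zero _).2 hx
  · intro y
    obtain ⟨y, rfl⟩ := mkQ_surjective _ y
    constructor
    · intro hy
      have hy' : (y : M) ∈ B := (Quotient.mk_eq_zero (B.submoduleOf C)).1 hy
      exact ⟨mkQ _ ⟨y, hy'⟩, rfl⟩
    · rintro ⟨x, hx⟩
      obtain ⟨x, rfl⟩ := mkQ_surjective _ x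
      rw [← hx]
      exact (Quotient.mk_eq_zero (B.submoduleOf C)).2 x.2

theorem relLength_self (A : Submodule R M) : A.relLength A = 0 := by
  have : A.submoduleOf A = ⊤ := by ext x; simp [submoduleOf]
  rw [relLength, Module.length_eq_zero_iff, this]
  infer_instance

/-- If a maximal ideal carries `x` into `A` but `x ∉ A`, then `(A + Rx) ⧸ A` is simple. -/
theorem relLength_sup_span_singleton {𝔪 : Ideal R} (h𝔪 : 𝔪.IsMaximal) {A : Submodule R M} {x : M}
    (hx : ∀ r ∈ 𝔪, r • x ∈ A) (hxA : x ∉ A) : A.relLength (A ⊔ span R {x}) = 1 := by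
  have hxB : x ∈ A ⊔ span R {x} := mem_sup_right (mem_span_singleton_self x)
  let f : R →ₗ[R] ↥(A ⊔ span R {x}) ⧸ A.submoduleOf (A ⊔ span R {x}) :=
    (mkQ _).comp (LinearMap.toSpanSingleton R _ ⟨x, hxB⟩)
  have hf : Function.Surjective f := by
    intro y
    obtain ⟨⟨y, hy⟩, rfl⟩ := mkQ_surjective _ y
    obtain ⟨a, ha, r, rfl⟩ := by
      simpa only [mem_sup, mem_span_singleton, exists_exists_eq_and] using hy
    refine ⟨r, (Submodule.Quotient.eq _).2 ?_⟩
    change r • x - (a + r • x) ∈ A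
    simpa using ha
  have hker : LinearMap.ker f = 𝔪 := by
    refine (h𝔪.eq_of_le ?_ ?_).symm
    · intro h
      have : f 1 = 0 := by rw [← LinearMap.mem_ker, h]; trivial
      have : (1 : R) • x ∈ A :=
        (Submodule.Quotient.mk_eq_zero (A.submoduleOf (A ⊔ span R {x}))).1 this
      exact hxA (by simpa using this)
    · intro r hr
      exact (Submodule.Quotient.mk_eq_zero _).2 (hx r hr : r • x ∈ A)
  have e := f.quotKerEquivOfSurjective hf
  rw [hker] at e
  have : IsSimpleModule R (R ⧸ 𝔪) := isSimpleModule_iff_isCoatom.2 h𝔪.out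
  rw [relLength, ← e.length_eq, Module.length_eq_one]

theorem relLength_sup_span_le {𝔪 : Ideal R} (h𝔪 : 𝔪.IsMaximal) {A : Submodule R M} (T : Finset M)
    (hT : ∀ x ∈ T, ∀ r ∈ 𝔪, r • x ∈ A) : A.relLength (A ⊔ span R T) ≤ T.card := by
  classical
  induction T using Finset.induction_on with
  | empty => simp [relLength_self]
  | insert x T hxT ih =>
    have ih := ih fun y hy => hT y (Finset.mem_insert_of_mem hy)
    have e : A ⊔ span R ↑(insert x T) = (A ⊔ span R T) ⊔ span R {x} := by
      rw [Finset.coe_insert, span_insert, sup_comm (span R {x}), sup_assoc]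
    rw [e, relLength_add (B := A ⊔ span R T) le_sup_left le_sup_left,
      Finset.card_insert_of_notMem hxT, Nat.cast_add, Nat.cast_one]
    refine add_le_add ih ?_
    by_cases hx : x ∈ A ⊔ span R (T : Set M)
    · rw [sup_eq_left.2 ((span_singleton_le_iff_mem _ _).2 hx), relLength_self]
      exact zero_le
    · exact (relLength_sup_span_singleton h𝔪
        (fun r hr => mem_sup_left (hT x (Finset.mem_insert_self _ _) r hr)) hx).le

/-- Elements that `𝔪` carries into `A` can be thinned out, without changing their span modulo `A`, to
a set with as many elements as the length requires. -/
theorem exists_subset_card_eq_relLength {𝔪 : Ideal R} (h𝔪 : 𝔪.IsMaximal) {A : Submodule R M}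
    (T : Finset M) (hT : ∀ x ∈ T, ∀ r ∈ 𝔪, r • x ∈ A) :
    ∃ T' ⊆ T, A ⊔ span R T' = A ⊔ span R T ∧ A.relLength (A ⊔ span R T) = T'.card := by
  classical
  induction T using Finset.induction_on with
  | empty => exact ⟨∅, subset_rfl, by simp [relLength_self]⟩
  | insert x T hxT ih =>
    obtain ⟨T', hT', hs, hc⟩ := ih fun y hy => hT y (Finset.mem_insert_of_mem hy)
    have e (T : Finset M) : A ⊔ span R ↑(insert x T) = (A ⊔ span R T) ⊔ span R {x} := by
      rw [Finset.coe_insert, span_insert, sup_comm (span R {x}), sup_assoc]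
    by_cases hx : x ∈ A ⊔ span R (T : Set M)
    · refine ⟨T', hT'.trans (Finset.subset_insert _ _), ?_⟩
      rw [e, sup_eq_left.2 ((span_singleton_le_iff_mem _ _).2 hx)]
      exact ⟨hs, hc⟩
    · refine ⟨insert x T', Finset.insert_subset_insert _ hT', by rw [e, e, hs], ?_⟩
      rw [e, relLength_add (B := A ⊔ span R T) le_sup_left le_sup_left, hc,
        relLength_sup_span_singleton h𝔪
          (fun r hr => mem_sup_left (hT x (Finset.mem_insert_self _ _) r hr)) hx,
        Finset.card_insert_of_notMem fun h => hxT (hT' h), Nat.cast_add, Nat.cast_one]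

theorem spanFinrank_top_quotient_le {N K : Submodule R M} (hKN : K ≤ N) (T : Finset M)
    (hT : N = span R T ⊔ K) :
    (⊤ : Submodule R (N ⧸ K.submoduleOf N)).spanFinrank ≤ T.card := by
  classical
  have hTN : ∀ x ∈ T, x ∈ N := fun x hx => hT ▸ mem_sup_left (subset_span hx)
  let U : Finset (N ⧸ K.submoduleOf N) := T.attach.image fun x => mkQ _ ⟨x.1, hTN x.1 x.2⟩
  have hU : span R (U : Set (N ⧸ K.submoduleOf N)) = ⊤ := by
    rw [eq_top_iff]
    rintro y -
    obtain ⟨⟨y, hy⟩, rfl⟩ := mkQ_surjective _ y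
    have key : N ≤ ((span R (U : Set (N ⧸ K.submoduleOf N))).comap (mkQ _)).map N.subtype := by
      refine hT.le.trans (sup_le (span_le.2 fun x hx => ⟨⟨x, hTN x hx⟩, ?_, rfl⟩) fun x hx =>
        ⟨⟨x, hKN hx⟩, ?_, rfl⟩)
      · exact subset_span (Finset.mem_coe.2 (Finset.mem_image.2
          ⟨⟨x, hx⟩, Finset.mem_attach _ _, rfl⟩))
      · have : mkQ (K.submoduleOf N) ⟨x, hKN hx⟩ = 0 := (Quotient.mk_eq_zero _).2 hx
        rw [SetLike.mem_coe, mem_comap, this]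
        exact zero_mem _
    obtain ⟨z, hz, hzy⟩ := key hy
    obtain rfl : z = ⟨y, hy⟩ := Subtype.ext hzy
    exact hz
  calc _ = (span R (U : Set (N ⧸ K.submoduleOf N))).spanFinrank := by rw [hU]
    _ ≤ (U : Set (N ⧸ K.submoduleOf N)).ncard := spanFinrank_span_le_ncard_of_finite U.finite_toSet
    _ ≤ T.card := by
      rw [Set.ncard_coe_finset]
      exact Finset.card_image_le.trans T.card_attach.le

theorem exists_finset_card_le_spanFinrank_top_quotient {N K : Submodule R M} (hN : N.FG)
    (hKN : K ≤ N) : ∃ T : Finset M, N = span R T ⊔ K ∧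
      T.card ≤ (⊤ : Submodule R (N ⧸ K.submoduleOf N)).spanFinrank := by
  classical
  have : Module.Finite R N := Module.Finite.iff_fg.2 hN
  obtain ⟨U, hc, hU⟩ := FG.exists_span_finset_card_eq_spanFinrank
    (Module.Finite.fg_top : (⊤ : Submodule R (N ⧸ K.submoduleOf N)).FG)
  choose f hf using mkQ_surjective (K.submoduleOf N)
  refine ⟨U.image fun u => (f u : M), le_antisymm ?_ (sup_le (span_le.2 ?_) hKN),
    hc ▸ Finset.card_image_le⟩
  · intro y hy
    have hle : span R (U : Set (N ⧸ K.submoduleOf N)) ≤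
        ((span R ((U.image fun u => (f u : M) : Finset M) : Set M) ⊔ K).comap N.subtype).map
          (mkQ _) := by
      refine span_le.2 fun u hu => ⟨f u, mem_sup_left (subset_span ?_), hf u⟩
      exact Finset.mem_coe.2 (Finset.mem_image_of_mem _ hu)
    rw [hU] at hle
    obtain ⟨z, hz, hzy⟩ := hle (trivial : mkQ (K.submoduleOf N) ⟨y, hy⟩ ∈ ⊤)
    have hzy' : (z : M) - y ∈ K := (Submodule.Quotient.eq (K.submoduleOf N)).1 hzy
    have := sub_mem (mem_comap.1 hz) (mem_sup_right hzy')
    simpa using this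
  · intro x hx
    obtain ⟨u, -, rfl⟩ := Finset.mem_image.1 (Finset.mem_coe.1 hx)
    exact (f u).2

/-- Nakayama's lemma in a form that covers local and graded-local rings alike: `S` is a generating
set of `N` such that, for `T ⊆ S`, the conductor of `N` into `⟨T⟩ + K` is either the unit ideal or
contained in `𝔪`. Then `N ⧸ K` needs as many generators as `N ⧸ (K + 𝔪N)` has length. -/
theorem spanFinrank_top_quotient_eq_relLength {𝔪 : Ideal R} (h𝔪 : 𝔪.IsMaximal)
    {N K : Submodule R M} (hN : N.FG) (hKN : K ≤ N) (S : Set M) (hS : span R S = N)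
    (h : ∀ T ⊆ S, (span R T ⊔ K).colon N ≠ ⊤ → (span R T ⊔ K).colon N ≤ 𝔪) :
    ((⊤ : Submodule R (N ⧸ K.submoduleOf N)).spanFinrank : ℕ∞) = (K ⊔ 𝔪 • N).relLength N := by
  have hle : K ⊔ 𝔪 • N ≤ N := sup_le hKN smul_le_right
  have hmem (x : M) (hx : x ∈ N) (r : R) (hr : r ∈ 𝔪) : r • x ∈ K ⊔ 𝔪 • N :=
    mem_sup_right (smul_mem_smul hr hx)
  apply le_antisymm
  · obtain ⟨T, hTS, hT⟩ := (fg_span_iff_fg_span_finset_subset S).1 (hS.symm ▸ hN)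
    rw [hS] at hT
    obtain ⟨T', hT', hs, hc⟩ := exists_subset_card_eq_relLength h𝔪 (A := K ⊔ 𝔪 • N) T
      fun x hx => hmem x (hT ▸ subset_span hx)
    have hsup : K ⊔ 𝔪 • N ⊔ N = N := sup_eq_right.2 hle
    rw [← hT, hsup] at hs hc
    rw [hc, Nat.cast_le]
    refine spanFinrank_top_quotient_le hKN T' ?_
    have hNle : N ≤ (span R (T' : Set M) ⊔ K) ⊔ 𝔪 • N := by
      conv_lhs => rw [← hs]
      exact sup_le (sup_le (le_sup_right.trans le_sup_left) le_sup_right)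
        (le_sup_left.trans le_sup_left)
    obtain ⟨r, hr, hrN⟩ := exists_sub_one_mem_and_smul_le_of_fg_of_le_sup hN le_rfl hNle
    have hr' : r ∈ (span R (T' : Set M) ⊔ K).colon N := hrN
    -- `r ≡ 1` modulo `𝔪`, so the conductor is not contained in `𝔪`.
    have htop : (span R (T' : Set M) ⊔ K).colon N = ⊤ := by
      by_contra hne
      refine h𝔪.ne_top ((Ideal.eq_top_iff_one _).2 ?_)
      simpa using sub_mem (h T' (fun x hx => hTS (hT' hx)) hne hr') hr
    rw [Submodule.colon_eq_top_iff_subset] at htop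
    refine le_antisymm htop (sup_le (span_le.2 fun x hx => ?_) hKN)
    rw [hT]
    exact subset_span (hT' hx)
  · obtain ⟨T, hT, hc⟩ := exists_finset_card_le_spanFinrank_top_quotient hN hKN
    have h1 := relLength_sup_span_le h𝔪 (A := K ⊔ 𝔪 • N) T
      fun x hx => hmem x (hT ▸ mem_sup_left (subset_span hx))
    have e : K ⊔ 𝔪 • N ⊔ span R (T : Set M) = N :=
      le_antisymm (sup_le hle (by rw [hT]; exact le_sup_left)) (by
        conv_lhs => rw [hT]
        exact sup_le le_sup_right (le_sup_left.trans le_sup_left))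
    rw [e] at h1
    exact h1.trans (by exact_mod_cast hc)

end Submodule

end Length

/-! ### Homogeneity of symbolic powers -/

section Graded

variable {σ R : Type*} [CommRing R] [SetLike σ R] [AddSubgroupClass σ R] {𝒜 : ℤ → σ}
  [GradedRing 𝒜]

open DirectSum

/-- The leading component of a product is the product of the leading components; either of them may
vanish. -/
theorem decompose_sum_mul_sum_apply_add {f x : ℤ → R} (hf : ∀ i, f i ∈ 𝒜 i) (hx : ∀ i, x i ∈ 𝒜 i)
    {F G : Finset ℤ} {a b : ℤ} (ha : ∀ i ∈ F, i < a) (hb : ∀ i ∈ G, i < b) :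
    (decompose 𝒜 ((f a + ∑ i ∈ F, f i) * (x b + ∑ i ∈ G, x i)) (a + b) : R) = f a * x b := by
  have key (i j : ℤ) (h : i + j ≠ a + b) : GradedRing.proj 𝒜 (a + b) (f i * x j) = 0 :=
    decompose_of_mem_ne 𝒜 (SetLike.mul_mem_graded (hf i) (hx j)) h
  have h0 : GradedRing.proj 𝒜 (a + b) (f a * x b) = f a * x b :=
    decompose_of_mem_same 𝒜 (SetLike.mul_mem_graded (hf a) (hx b))
  rw [← GradedRing.proj_apply, add_mul, mul_add, Finset.mul_sum, Finset.sum_mul]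
  simp only [mul_add, Finset.mul_sum, map_add, map_sum, h0]
  rw [Finset.sum_eq_zero fun j hj => key a j (by have := hb j hj; lia),
    Finset.sum_eq_zero fun i hi => ?_, add_zero, add_zero]
  rw [key i b (by have := ha i hi; lia), Finset.sum_eq_zero fun j hj =>
      key i j (by have := ha i hi; have := hb j hj; lia), add_zero]

/-- If `s * x` lies in a homogeneous ideal, then so does the product of `x` with some power of the
leading component of `s`. The components of `x` are dealt with one at a time, starting from
the top: the leading component of `s * x` is the product of those of `s` and `x`. -/
theorem Ideal.IsHomogeneous.exists_leading_pow_mul_mem {J : Ideal R} (hJ : J.IsHomogeneous 𝒜)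
    {f : ℤ → R} (hf : ∀ i, f i ∈ 𝒜 i) {F : Finset ℤ} {a : ℤ} (ha : ∀ i ∈ F, i < a) {x : R}
    (h : (f a + ∑ i ∈ F, f i) * x ∈ J) : ∃ N, f a ^ N * x ∈ J := by
  classical
  suffices H : ∀ (G : Finset ℤ) (x : ℤ → R) (_ : ∀ i, x i ∈ 𝒜 i) (k : ℕ),
      (f a + ∑ i ∈ F, f i) * (f a ^ k * ∑ i ∈ G, x i) ∈ J →
      ∃ N, f a ^ N * ∑ i ∈ G, x i ∈ J by
    have := H (decompose 𝒜 x).support (fun i => decompose 𝒜 x i) (fun i => SetLike.coe_mem _) 0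
    rw [sum_support_decompose 𝒜 x] at this
    exact this (by simpa using h)
  intro G x hx
  induction G using Finset.induction_on_max with
  | empty => exact fun k _ => ⟨0, by simp⟩
  | insert b G hb ih =>
    intro k hk
    have hbG : b ∉ G := fun h => (hb b h).false
    rw [Finset.sum_insert hbG] at hk ⊢
    -- The component of `f a ^ k * s * x` in degree `a + b + k • a`.
    have hlead : f a ^ (k + 1) * x b ∈ J := by
      have hk' : (f a + ∑ i ∈ F, f i) * (x b + ∑ i ∈ G, x i) * f a ^ k ∈ J := by
        convert hk using 1; ring
      have hpow : f a ^ k ∈ 𝒜 (k • a) := SetLike.pow_mem_graded k (hf a)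
      have := hJ (a + b + k • a) hk'
      rw [coe_decompose_mul_add_of_right_mem 𝒜 hpow,
        decompose_sum_mul_sum_apply_add hf hx ha hb] at this
      convert this using 1; ring
    obtain ⟨N, hN⟩ := ih (k + 1) (by
      convert sub_mem (J.mul_mem_left (f a) hk)
        (J.mul_mem_left (f a + ∑ i ∈ F, f i) hlead) using 1
      ring)
    refine ⟨N + (k + 1), ?_⟩
    convert add_mem (J.mul_mem_left (f a ^ N) hlead) (J.mul_mem_left (f a ^ (k + 1)) hN) using 1
    ring

/-- For a homogeneous ideal `J` and an arbitrary element `x`, the elements some power of which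
multiplies `x` into `J` form a homogeneous ideal. -/
theorem Ideal.IsHomogeneous.radical_colon_singleton {J : Ideal R} (hJ : J.IsHomogeneous 𝒜)
    (x : R) : (J.colon {x}).radical.IsHomogeneous 𝒜 := by
  classical
  have hmem (s : R) : s ∈ (J.colon {x}).radical ↔ ∃ n : ℕ, s ^ n * x ∈ J := by
    simp only [Ideal.mem_radical_iff, Submodule.mem_colon_singleton, smul_eq_mul]
  have hlead (f : ℤ → R) (hf : ∀ i, f i ∈ 𝒜 i) (F : Finset ℤ) (a : ℤ) (ha : ∀ i ∈ F, i < a)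
      (n : ℕ) : ∀ x, (f a + ∑ i ∈ F, f i) ^ n * x ∈ J → ∃ N, f a ^ N * x ∈ J := by
    induction n with
    | zero => exact fun x h => ⟨0, by simpa using h⟩
    | succ n ih =>
      intro x h
      obtain ⟨N, hN⟩ := ih ((f a + ∑ i ∈ F, f i) * x) (by convert h using 1; ring)
      obtain ⟨M, hM⟩ := hJ.exists_leading_pow_mul_mem hf ha (x := f a ^ N * x)
        (by convert hN using 1; ring)
      exact ⟨M + N, by convert hM using 1; ring⟩
  have main (f : ℤ → R) (hf : ∀ i, f i ∈ 𝒜 i) (F : Finset ℤ) :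
      ∑ i ∈ F, f i ∈ (J.colon {x}).radical → ∀ i ∈ F, f i ∈ (J.colon {x}).radical := by
    induction F using Finset.induction_on_max with
    | empty => simp
    | insert a F ha ih =>
      intro h
      rw [Finset.sum_insert fun h => (ha a h).false] at h
      obtain ⟨n, hn⟩ := (hmem _).1 h
      have hfa := (hmem _).2 (hlead f hf F a ha n x hn)
      have hF := ih (by simpa using sub_mem h hfa)
      intro i hi
      rcases Finset.mem_insert.1 hi with rfl | hi
      exacts [hfa, hF i hi]
  intro i s hs
  by_cases hi : i ∈ (decompose 𝒜 s).support
  · refine main (fun i => decompose 𝒜 s i) (fun i => SetLike.coe_mem _)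
      (decompose 𝒜 s).support ?_ i hi
    rwa [sum_support_decompose 𝒜 s]
  · rw [DFinsupp.notMem_support_iff.1 hi]
    exact zero_mem _

/-- Contractions of homogeneous ideals from the localization at a prime ideal are homogeneous,
even if the prime is not. -/
theorem Ideal.IsHomogeneous.comap_map_localization {J : Ideal R} (hJ : J.IsHomogeneous 𝒜)
    (p : Ideal R) [p.IsPrime] :
    ((J.map (algebraMap R (Localization.AtPrime p))).comap
      (algebraMap R (Localization.AtPrime p))).IsHomogeneous 𝒜 := by
  classical
  intro i x hx
  rw [Ideal.mem_comap, IsLocalization.algebraMap_mem_map_algebraMap_iff p.primeCompl] at hx ⊢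
  obtain ⟨s, hs, hsx⟩ := hx
  obtain ⟨j, hj⟩ : ∃ j, (decompose 𝒜 s j : R) ∉ p := by
    by_contra! h
    exact hs (sum_support_decompose 𝒜 s ▸ Ideal.sum_mem p fun j _ => h j)
  have hrad : s ∈ (J.colon {x}).radical :=
    Ideal.le_radical (Submodule.mem_colon_singleton.2 hsx)
  obtain ⟨n, hn⟩ := hJ.radical_colon_singleton x j hrad
  rw [Submodule.mem_colon_singleton, smul_eq_mul] at hn
  refine ⟨(decompose 𝒜 s j : R) ^ n, p.primeCompl.pow_mem hj n, ?_⟩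
  rw [← coe_decompose_mul_add_of_left_mem 𝒜 (SetLike.pow_mem_graded n (SetLike.coe_mem _))]
  exact hJ _ hn

theorem Ideal.IsHomogeneous.pow {J : Ideal R} (hJ : J.IsHomogeneous 𝒜) (n : ℕ) :
    (J ^ n).IsHomogeneous 𝒜 := by
  induction n with
  | zero => simpa using Ideal.IsHomogeneous.top 𝒜
  | succ n ih => exact pow_succ J n ▸ ih.mul hJ

theorem Ideal.IsHomogeneous.symbolicPower {J : Ideal R} (hJ : J.IsHomogeneous 𝒜) (n : ℕ) :
    (J.symbolicPower n).IsHomogeneous 𝒜 :=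
  Ideal.IsHomogeneous.iInf₂ fun p hp =>
    have : p.IsPrime := hp.isPrime
    (hJ.pow n).comap_map_localization p

theorem Ideal.IsHomogeneous.colon {J N : Ideal R} (hJ : J.IsHomogeneous 𝒜)
    (hN : N.IsHomogeneous 𝒜) : (J.colon (N : Set R)).IsHomogeneous 𝒜 := by
  classical
  intro i r hr
  rw [Submodule.mem_colon] at hr ⊢
  intro n hn
  rw [← sum_support_decompose 𝒜 n, smul_eq_mul, Finset.mul_sum]
  refine Ideal.sum_mem _ fun j _ => ?_
  rw [← coe_decompose_mul_add_of_right_mem 𝒜 (SetLike.coe_mem _)]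
  exact hJ _ (hr _ (hN j hn))

theorem Ideal.IsHomogeneous.span_homogeneous_eq {N : Ideal R} (hN : N.IsHomogeneous 𝒜) :
    Ideal.span {x | x ∈ N ∧ SetLike.IsHomogeneousElem 𝒜 x} = N := by
  classical
  refine le_antisymm (Ideal.span_le.2 fun x hx => hx.1) fun x hx => ?_
  rw [← sum_support_decompose 𝒜 x]
  exact Ideal.sum_mem _ fun j _ => Ideal.subset_span ⟨hN j hx, j, SetLike.coe_mem _⟩

end Graded

/-! ### The symbolic defect as a length -/

/-- Over a local or graded-local ring the symbolic defect is a length, by Nakayama's lemma. -/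
theorem exists_isMaximal_symbolicDefect_eq_relLength {R : Type*} [CommRing R] [IsNoetherianRing R]
    (I : Ideal R)
    (hR : IsLocalRing R ∨
      ∃ (𝒜 : ℤ → AddSubgroup R) (_ : GradedRing 𝒜), IsGradedLocal 𝒜 ∧ I.IsHomogeneous 𝒜) :
    ∃ 𝔪 : Ideal R, 𝔪.IsMaximal ∧ ∀ m, (symbolicDefect I m : ℕ∞) =
      (I ^ m ⊔ 𝔪 • I.symbolicPower m).relLength (I.symbolicPower m) := by
  rcases hR with hR | ⟨𝒜, _, ⟨𝔪, h𝔪, -, hmax⟩, hI⟩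
  · exact ⟨IsLocalRing.maximalIdeal R, inferInstance, fun m =>
      Submodule.spanFinrank_top_quotient_eq_relLength inferInstance (IsNoetherian.noetherian _)
        (I.pow_le_symbolicPower m) (I.symbolicPower m) (Submodule.span_eq _)
        fun T _ hT => IsLocalRing.le_maximalIdeal hT⟩
  · refine ⟨𝔪, h𝔪, fun m => Submodule.spanFinrank_top_quotient_eq_relLength h𝔪
      (IsNoetherian.noetherian _) (I.pow_le_symbolicPower m) _
      (hI.symbolicPower m).span_homogeneous_eq fun T hT hne => hmax _ ?_ hne⟩
    exact ((Ideal.homogeneous_span 𝒜 T fun x hx => (hT hx).2).sup (hI.pow m)).colon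
      (hI.symbolicPower m)

/-! ### Eventual quasi-polynomials -/

section QuasiPolynomial

open Filter

/-- The restriction of `f` to each residue class modulo `n` eventually agrees with a polynomial,
here taken in the variable `q` of `n * q + r`. The representative `r` is not required to be less
than `n`. -/
def EventuallyQuasiPolynomial (f : ℕ → ℚ) (n : ℕ) : Prop :=
  ∀ r : ℕ, ∃ P : ℚ[X], ∀ᶠ q : ℕ in atTop, f (n * q + r) = P.eval (q : ℚ)

namespace EventuallyQuasiPolynomial

variable {f g : ℕ → ℚ} {n : ℕ}

theorem congr (hf : EventuallyQuasiPolynomial f n) (h : ∀ m, g m = f m) :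
    EventuallyQuasiPolynomial g n := funext h ▸ hf

theorem zero : EventuallyQuasiPolynomial (fun _ => 0) n := fun _ => ⟨0, by simp⟩

theorem add (hf : EventuallyQuasiPolynomial f n) (hg : EventuallyQuasiPolynomial g n) :
    EventuallyQuasiPolynomial (fun m => f m + g m) n := fun r => by
  obtain ⟨P, hP⟩ := hf r
  obtain ⟨P', hP'⟩ := hg r
  refine ⟨P + P', ?_⟩
  filter_upwards [hP, hP'] with q h h'
  rw [eval_add, h, h']

theorem sub (hf : EventuallyQuasiPolynomial f n) (hg : EventuallyQuasiPolynomial g n) :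
    EventuallyQuasiPolynomial (fun m => f m - g m) n := fun r => by
  obtain ⟨P, hP⟩ := hf r
  obtain ⟨P', hP'⟩ := hg r
  refine ⟨P - P', ?_⟩
  filter_upwards [hP, hP'] with q h h'
  rw [eval_sub, h, h']

theorem sum {ι : Type*} {s : Finset ι} {f : ι → ℕ → ℚ}
    (hf : ∀ i ∈ s, EventuallyQuasiPolynomial (f i) n) :
    EventuallyQuasiPolynomial (fun m => ∑ i ∈ s, f i m) n := by
  classical
  induction s using Finset.induction_on with
  | empty => exact zero.congr (by simp)
  | insert a s ha ih =>
    exact ((hf a (s.mem_insert_self a)).add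
      (ih fun i hi => hf i (Finset.mem_insert_of_mem hi))).congr fun m => Finset.sum_insert ha

theorem shift (hf : EventuallyQuasiPolynomial f n) (c : ℕ) :
    EventuallyQuasiPolynomial (fun m => f (m + c)) n := fun r => by
  simpa only [add_assoc] using hf (r + c)

/-- For `n ∣ k + c`, the values of `f` at `n * q + r` are, up to a translation of `q`, those of the
shifted function at `n * q + (k + r)`; here `k = n * c - c`. -/
theorem of_shift (hn : 0 < n) {c : ℕ} (hf : EventuallyQuasiPolynomial (fun m => f (m + c)) n) :
    EventuallyQuasiPolynomial f n := fun r => by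
  obtain ⟨k, hk⟩ : ∃ k, n * c = c + k := Nat.exists_eq_add_of_le (Nat.le_mul_of_pos_left c hn)
  obtain ⟨P, hP⟩ := hf (k + r)
  refine ⟨P.comp (X - C (c : ℚ)), ?_⟩
  filter_upwards [(tendsto_sub_atTop_nat c).eventually hP, eventually_ge_atTop c] with q h hq
  obtain ⟨q, rfl⟩ := Nat.exists_eq_add_of_le' hq
  rw [Nat.add_sub_cancel] at h
  rw [eval_comp, eval_sub, eval_X, eval_C, Nat.cast_add, add_sub_cancel_right, ← h]
  congr 1
  rw [mul_add, hk]
  ring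

end EventuallyQuasiPolynomial

/-- Every rational polynomial has a polynomial antidifference; those of the monomials are Bernoulli
polynomials. -/
theorem Polynomial.exists_eval_add_one_sub_eval (P : ℚ[X]) :
    ∃ S : ℚ[X], ∀ x : ℚ, S.eval (x + 1) - S.eval x = P.eval x := by
  induction P using Polynomial.induction_on' with
  | add p q hp hq =>
    obtain ⟨S, hS⟩ := hp
    obtain ⟨T, hT⟩ := hq
    refine ⟨S + T, fun x => ?_⟩
    rw [eval_add, eval_add, eval_add, ← hS, ← hT]
    ring
  | monomial k a =>
    refine ⟨C (a / (k + 1)) * bernoulli (k + 1), fun x => ?_⟩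
    rw [eval_mul, eval_mul, add_comm x, bernoulli_eval_one_add, eval_monomial]
    simp only [eval_C]
    have : (k + 1 : ℚ) ≠ 0 := by positivity
    push_cast
    field_simp
    ring

namespace EventuallyQuasiPolynomial

variable {f : ℕ → ℚ} {n : ℕ}

/-- Taking differences with step `n` acts on a residue class modulo `n` as the usual difference
operator, so the antidifference of a polynomial reconstructs `f` up to a constant. -/
theorem of_sub (h : EventuallyQuasiPolynomial (fun m => f (m + n) - f m) n) :
    EventuallyQuasiPolynomial f n := fun r => by
  obtain ⟨P, hP⟩ := h r
  obtain ⟨S, hS⟩ := P.exists_eval_add_one_sub_eval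
  obtain ⟨q₀, hq₀⟩ := eventually_atTop.1 hP
  refine ⟨S + C (f (n * q₀ + r) - S.eval (q₀ : ℚ)), eventually_atTop.2 ⟨q₀, fun q hq => ?_⟩⟩
  induction q, hq using Nat.le_induction with
  | base => simp
  | succ q hq ih =>
    have h1 := hq₀ q hq
    have h2 := hS q
    simp only [show n * q + r + n = n * (q + 1) + r by ring] at h1
    rw [eval_add, eval_C] at ih ⊢
    push_cast
    linarith

theorem of_sub_of_dvd {c : ℕ} (hc : c ∣ n)
    (h : EventuallyQuasiPolynomial (fun m => f (m + c) - f m) n) :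
    EventuallyQuasiPolynomial f n := by
  obtain ⟨k, rfl⟩ := hc
  refine of_sub ((sum (s := Finset.range k) fun i _ => h.shift (i * c)).congr fun m => ?_)
  have := Finset.sum_range_sub (fun i => f (m + i * c)) k
  rw [zero_mul, add_zero, mul_comm k c] at this
  rw [← this]
  refine Finset.sum_congr rfl fun i _ => ?_
  rw [show m + (i + 1) * c = m + i * c + c by ring]

theorem exists_hasQuasiPeriod (hn : 0 < n) (hf : EventuallyQuasiPolynomial f n) :
    ∃ Q : ℕ → ℚ, HasQuasiPeriod Q n ∧ ∀ᶠ m in atTop, f m = Q m := by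
  choose P hP using hf
  have hn' : (n : ℚ) ≠ 0 := by positivity
  refine ⟨fun m => (P (m % n)).eval ((m / n : ℕ) : ℚ),
    ⟨hn, fun r => (P r).comp (C (1 / n : ℚ) * (X - C (r : ℚ))), fun r m hm => ?_⟩, ?_⟩
  · have hr : m % n = r := (show m % n = r % n from hm).trans (Nat.mod_eq_of_lt r.2)
    have e : (m : ℚ) = n * (m / n : ℕ) + r := by
      rw [← hr]; exact_mod_cast (Nat.div_add_mod m n).symm
    simp only [hr]
    rw [eval_comp, eval_mul, eval_sub, eval_X, eval_C, eval_C, e]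
    congr 1
    field_simp
    ring
  · have h : ∀ᶠ q : ℕ in atTop, ∀ r : Fin n, f (n * q + r) = (P r).eval (q : ℚ) :=
      eventually_all.2 fun r => hP r
    filter_upwards [(Nat.tendsto_div_const_atTop hn.ne').eventually h] with m hm
    have := hm ⟨m % n, Nat.mod_lt _ hn⟩
    rwa [Nat.div_add_mod] at this

end EventuallyQuasiPolynomial

/-- Quasi-polynomials that agree at all large arguments are equal. -/
theorem HasQuasiPeriod.eq_of_eventuallyEq {Q Q' : ℕ → ℚ} {n n' : ℕ} (hQ : HasQuasiPeriod Q n)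
    (hQ' : HasQuasiPeriod Q' n') (h : ∀ᶠ m in atTop, Q m = Q' m) : Q = Q' := by
  obtain ⟨hn, P, hP⟩ := hQ
  obtain ⟨hn', P', hP'⟩ := hQ'
  funext m
  let r : Fin n := ⟨m % n, Nat.mod_lt _ hn⟩
  let r' : Fin n' := ⟨m % n', Nat.mod_lt _ hn'⟩
  have hr (k : ℕ) (hk : m ≡ k [MOD n]) : Q k = (P r).eval (k : ℚ) :=
    hP r k (hk.symm.trans (Nat.mod_modEq m n).symm)
  have hr' (k : ℕ) (hk : m ≡ k [MOD n']) : Q' k = (P' r').eval (k : ℚ) :=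
    hP' r' k (hk.symm.trans (Nat.mod_modEq m n').symm)
  have heq : P r = P' r' := by
    obtain ⟨N, hN⟩ := eventually_atTop.1 h
    refine eq_of_infinite_eval_eq _ _ (Set.infinite_of_injective_forall_mem
      (f := fun q : ℕ => ((m + n * n' * (N + q) : ℕ) : ℚ)) ?_ fun q => ?_)
    · intro a b hab
      have := Nat.cast_injective hab
      simpa [hn.ne', hn'.ne'] using this
    · have hle : N ≤ m + n * n' * (N + q) := by
        have := Nat.le_mul_of_pos_left (N + q) (Nat.mul_pos hn hn')
        lia
      have := hN _ hle
      rwa [hr _ ?_, hr' _ ?_] at this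
      · rw [mul_comm n n', mul_assoc]; exact (Nat.add_mul_mod_self_left m n' _).symm
      · rw [mul_assoc]; exact (Nat.add_mul_mod_self_left m n _).symm
  rw [hr m rfl, hr' m rfl, heq]

end QuasiPolynomial

/-! ### Counting points of lower sets -/

section LowerSets

/-- A well-quasi-order satisfies the descending chain condition on lower sets. -/
theorem LowerSet.wellFoundedLT_of_wellQuasiOrderedLE {α : Type*} [Preorder α]
    [WellQuasiOrderedLE α] : WellFoundedLT (LowerSet α) := by
  rw [WellFoundedLT, isWellFounded_iff, wellFounded_iff_isEmpty_descending_chain]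
  refine ⟨fun ⟨D, hD⟩ => ?_⟩
  choose x hx hx' using fun i => Set.exists_of_ssubset (LowerSet.coe_ssubset_coe.2 (hD i))
  obtain ⟨i, j, hij, hle⟩ := wellQuasiOrdered_le x
  exact hx' i ((D (i + 1)).lower hle (antitone_nat_of_succ_le (fun k => (hD k).le)
    (Nat.succ_le_of_lt hij) (hx j)))

theorem finite_setOf_sum_mul_eq {s : ℕ} {d : Fin s → ℕ} (hd : ∀ i, 0 < d i) (m : ℕ) :
    {α : Fin s → ℕ | ∑ i, d i * α i = m}.Finite := by
  refine (Set.finite_Iic (fun _ : Fin s => m)).subset fun α hα i => ?_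
  exact (Nat.le_mul_of_pos_left _ (hd i)).trans
    ((Finset.single_le_sum (f := fun i => d i * α i) (fun _ _ => Nat.zero_le _)
      (Finset.mem_univ i)).trans hα.le)

open Classical in
/-- The number of points of weighted degree `m` in a lower set of `ℕ ^ s` is eventually a
quasi-polynomial in `m`. The induction is on `s` and on the lower set `D`: the points of `D` whose
first coordinate is positive correspond to the lower set `D' ⊆ D` of those `α` with `α + e₀ ∈ D`,
and the other points to a lower set in one dimension less. If `D' = D`, this computes the
differences of the counting function with step `d 0`. -/
theorem LowerSet.eventuallyQuasiPolynomial_ncard {s : ℕ} {d : Fin s → ℕ} (hd : ∀ i, 0 < d i)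
    {n : ℕ} (hn : 0 < n) (hdn : ∀ i, d i ∣ n) (D : LowerSet (Fin s → ℕ)) :
    EventuallyQuasiPolynomial
      (fun m => ({α : Fin s → ℕ | α ∈ D ∧ ∑ i, d i * α i = m}.ncard : ℚ)) n := by
  induction s with
  | zero =>
    -- The only point has degree `0`, so the count vanishes for `m ≥ 1`.
    refine .of_shift hn (c := 1) (EventuallyQuasiPolynomial.zero.congr fun m => ?_)
    simp
  | succ s ih =>
    have : WellFoundedLT (LowerSet (Fin (s + 1) → ℕ)) :=
      LowerSet.wellFoundedLT_of_wellQuasiOrderedLE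
    induction D using WellFoundedLT.induction with
    | ind D IH =>
    let e : Fin (s + 1) → ℕ := Pi.single 0 1
    let D' : LowerSet (Fin (s + 1) → ℕ) :=
      ⟨{α | α + e ∈ D}, fun α β hle hα => D.lower (add_le_add_left hle e) hα⟩
    let D₀ : LowerSet (Fin s → ℕ) :=
      ⟨{α | Fin.cons 0 α ∈ D}, fun α β hle hα =>
        D.lower (Fin.cons_le_cons.2 ⟨le_rfl, hle⟩) hα⟩
    have hle : D' ≤ D := fun α hα => D.lower (le_self_add : α ≤ α + e) hα
    have hdeg (α : Fin (s + 1) → ℕ) : ∑ i, d i * (α + e) i = ∑ i, d i * α i + d 0 := by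
      simp [e, mul_add, Finset.sum_add_distrib, Pi.single_apply]
    have hcount (m : ℕ) :
        ({α : Fin (s + 1) → ℕ | α ∈ D ∧ ∑ i, d i * α i = m + d 0}.ncard : ℚ) =
          {α : Fin (s + 1) → ℕ | α ∈ D' ∧ ∑ i, d i * α i = m}.ncard +
          {α : Fin s → ℕ | α ∈ D₀ ∧ ∑ i, Fin.tail d i * α i = m + d 0}.ncard := by
      have hunion : {α : Fin (s + 1) → ℕ | α ∈ D ∧ ∑ i, d i * α i = m + d 0} =
          (fun α => α + e) '' {α : Fin (s + 1) → ℕ | α ∈ D' ∧ ∑ i, d i * α i = m} ∪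
          Fin.cons 0 '' {α : Fin s → ℕ | α ∈ D₀ ∧ ∑ i, Fin.tail d i * α i = m + d 0} := by
        ext α
        constructor
        · rintro ⟨hα, hm⟩
          rcases Nat.eq_zero_or_pos (α 0) with h0 | h0
          · refine Or.inr ⟨Fin.tail α, ⟨?_, ?_⟩, ?_⟩
            · change Fin.cons 0 (Fin.tail α) ∈ D
              rwa [← h0, Fin.cons_self_tail]
            · rw [Fin.sum_univ_succ, h0, mul_zero, zero_add] at hm
              exact hm
            · rw [← h0, Fin.cons_self_tail]
          · have hαe : α - e + e = α := tsub_add_cancel_of_le fun i => by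
              by_cases hi : i = 0
              · subst hi; simpa [e] using Nat.succ_le_of_lt h0
              · simp [e, hi]
            refine Or.inl ⟨α - e, ⟨?_, ?_⟩, hαe⟩
            · change α - e + e ∈ D
              rwa [hαe]
            · have := hdeg (α - e)
              rw [hαe, hm] at this
              exact (Nat.add_right_cancel this).symm
        · rintro (⟨β, ⟨hβ, hm⟩, rfl⟩ | ⟨β, ⟨hβ, hm⟩, rfl⟩)
          · exact ⟨hβ, by rw [hdeg, hm]⟩
          · refine ⟨hβ, ?_⟩
            rw [Fin.sum_univ_succ, Fin.cons_zero, mul_zero, zero_add, ← hm]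
            simp [Fin.tail]
      rw [hunion, Set.ncard_union_eq ?_
        (((finite_setOf_sum_mul_eq hd m).subset fun α h => h.2).image _)
        (((finite_setOf_sum_mul_eq (fun i => hd i.succ) _).subset fun α h => h.2).image _),
        Set.ncard_image_of_injective _ (add_left_injective e),
        Set.ncard_image_of_injective _ (Fin.cons_right_injective (α := fun _ => ℕ) 0), Nat.cast_add]
      · rw [Set.disjoint_left]
        rintro _ ⟨β, -, rfl⟩ ⟨γ, -, h⟩
        have := congrFun h 0
        simp [e] at this
    have h₀ := (ih (d := Fin.tail d) (fun i => hd _) (fun i => hdn _) D₀).shift (d 0)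
    rcases hle.eq_or_lt with heq | hlt
    · rw [heq] at hcount
      exact .of_sub_of_dvd (hdn 0) (h₀.congr fun m => by rw [hcount, add_sub_cancel_left])
    · exact .of_shift hn (((IH D' hlt).add h₀).congr hcount)

end LowerSets

/-! ### Standard monomials -/

section StandardMonomials

variable {R : Type*} [CommRing R] {s : ℕ}

/-- The exponents of the standard monomials, relative to a family `F` of ideals indexed by the
weighted degree: those `α` for which `a ^ α` is not congruent modulo `F` to a linear combination of
lexicographically smaller monomials of the same weighted degree. -/
def standardExponents (a : Fin s → R) (d : Fin s → ℕ) (F : ℕ → Ideal R) : Set (Fin s → ℕ) :=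
  {α | ∏ i, a i ^ α i ∉ F (∑ i, d i * α i) ⊔ Submodule.span R ((fun β => ∏ i, a i ^ β i) ''
    {β : Fin s → ℕ | toLex β < toLex α ∧ ∑ i, d i * β i = ∑ i, d i * α i})}

variable {a : Fin s → R} {d : Fin s → ℕ} {F : ℕ → Ideal R}

/-- A multiple of a nonstandard monomial is nonstandard, because the lexicographic order is
compatible with addition of exponents. -/
theorem isLowerSet_standardExponents
    (hF : ∀ (α : Fin s → ℕ) (m : ℕ), ∀ x ∈ F m, (∏ i, a i ^ α i) * x ∈ F (∑ i, d i * α i + m)) :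
    IsLowerSet (standardExponents a d F) := by
  intro α β hle hα hβ
  apply hα
  obtain ⟨γ, rfl⟩ := exists_add_of_le hle
  have hmon (β δ : Fin s → ℕ) : ∏ i, a i ^ (β + δ) i = (∏ i, a i ^ δ i) * ∏ i, a i ^ β i := by
    simp only [Pi.add_apply, pow_add, Finset.prod_mul_distrib, mul_comm]
  have hdeg (β δ : Fin s → ℕ) : ∑ i, d i * (β + δ) i = ∑ i, d i * δ i + ∑ i, d i * β i := by
    simp only [Pi.add_apply, mul_add, Finset.sum_add_distrib, add_comm]
  obtain ⟨x, hx, y, hy, hxy⟩ := Submodule.mem_sup.1 hβ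
  clear hα hβ
  rw [hmon, ← hxy, mul_add]
  clear hxy
  refine Submodule.add_mem_sup (hdeg β γ ▸ hF γ _ x hx) ?_
  induction hy using Submodule.span_induction with
  | mem z hz =>
    obtain ⟨δ, ⟨hlt, hδ⟩, rfl⟩ := hz
    refine Submodule.subset_span ⟨δ + γ, ⟨?_, ?_⟩, ?_⟩
    · rw [toLex_add, toLex_add]
      exact add_lt_add_left hlt _
    · rw [hdeg, hdeg, hδ]
    · exact hmon δ γ
  | zero => rw [mul_zero]; exact zero_mem _
  | add y z _ _ hy hz => rw [mul_add]; exact add_mem hy hz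
  | smul r y _ hy => rw [mul_smul_comm]; exact Submodule.smul_mem _ r hy

/-- The standard monomials of weighted degree `m` measure the length, over `F m`, of what all
monomials of that degree span: each standard monomial adds a simple factor and the others add nothing. -/
theorem relLength_span_monomials_eq_ncard {𝔪 : Ideal R} (h𝔪 : 𝔪.IsMaximal) (hd : ∀ i, 0 < d i)
    (hmF : ∀ (α : Fin s → ℕ), ∀ r ∈ 𝔪, r * ∏ i, a i ^ α i ∈ F (∑ i, d i * α i)) (m : ℕ) :
    (F m).relLength (F m ⊔ Submodule.span R ((fun β => ∏ i, a i ^ β i) ''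
      {β : Fin s → ℕ | ∑ i, d i * β i = m})) =
    ({α | α ∈ standardExponents a d F ∧ ∑ i, d i * α i = m}.ncard : ℕ∞) := by
  classical
  let deg (α : Lex (Fin s → ℕ)) : ℕ := ∑ i, d i * ofLex α i
  let mon (α : Lex (Fin s → ℕ)) : R := ∏ i, a i ^ ofLex α i
  -- Induction over the initial segments of the monomials of degree `m`.
  have main (T : Finset (Lex (Fin s → ℕ))) (hT : ∀ α ∈ T, deg α = m)
      (hlow : ∀ α ∈ T, ∀ β < α, deg β = m → β ∈ T) :
      (F m).relLength (F m ⊔ Submodule.span R (mon '' T)) =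
        ((T.filter fun α => ofLex α ∈ standardExponents a d F).card : ℕ∞) := by
    induction T using Finset.induction_on_max with
    | empty => simp [Submodule.relLength_self]
    | insert α T hα ih =>
      have hαT : α ∉ T := fun h => (hα α h).false
      have ih := ih (fun β hβ => hT β (Finset.mem_insert_of_mem hβ)) fun β hβ γ hγ hm =>
        Finset.mem_of_mem_insert_of_ne (hlow β (Finset.mem_insert_of_mem hβ) γ hγ hm)
          (hγ.trans (hα β hβ)).ne
      have hdeg : deg α = m := hT α (Finset.mem_insert_self _ _)
      have hset : (fun β => ∏ i, a i ^ β i) '' {β : Fin s → ℕ | toLex β < toLex (ofLex α) ∧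
          ∑ i, d i * β i = ∑ i, d i * ofLex α i} = mon '' T := by
        ext x
        constructor
        · rintro ⟨β, ⟨hlt, hβ⟩, rfl⟩
          exact ⟨toLex β, Finset.mem_of_mem_insert_of_ne (hlow α (Finset.mem_insert_self _ _)
            (toLex β) hlt (hβ.trans hdeg)) hlt.ne, rfl⟩
        · rintro ⟨β, hβ, rfl⟩
          exact ⟨ofLex β, ⟨hα β hβ, (hT β (Finset.mem_insert_of_mem hβ)).trans hdeg.symm⟩, rfl⟩
      have hstd : ofLex α ∈ standardExponents a d F ↔
          mon α ∉ F m ⊔ Submodule.span R (mon '' T) := by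
        rw [← hset, ← hdeg]; rfl
      have e : F m ⊔ Submodule.span R (mon '' ↑(insert α T)) =
          (F m ⊔ Submodule.span R (mon '' T)) ⊔ Submodule.span R {mon α} := by
        rw [Finset.coe_insert, Set.image_insert_eq, Submodule.span_insert,
          sup_comm (Submodule.span R {mon α}), sup_assoc]
      rw [e, Finset.filter_insert]
      split_ifs with h
      · rw [Submodule.relLength_add (B := F m ⊔ Submodule.span R (mon '' T)) le_sup_left
          le_sup_left, ih, Submodule.relLength_sup_span_singleton h𝔪 (fun r hr => Submodule.mem_sup_left
            (hdeg ▸ hmF (ofLex α) r hr)) (hstd.1 h),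
          Finset.card_insert_of_notMem fun h => hαT (Finset.mem_filter.1 h).1,
          Nat.cast_add, Nat.cast_one]
      · rw [sup_eq_left.2, ih]
        rw [Submodule.span_singleton_le_iff_mem]
        by_contra hc
        exact h (hstd.2 hc)
  have hfin : {α : Lex (Fin s → ℕ) | deg α = m}.Finite := finite_setOf_sum_mul_eq hd m
  have := main hfin.toFinset (by simp) (fun α _ β _ hβ => by simpa using hβ)
  rw [hfin.coe_toFinset, ← Set.ncard_coe_finset] at this
  refine this.trans ?_
  congr 2
  ext α
  simp [deg, and_comm]
  rfl

end StandardMonomials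

/-! ### Ideals spanned by monomials -/

section SpanMonomials

variable {R : Type*} [CommRing R] {s : ℕ}

/-- The ideal spanned by the monomials in the `a i` of weighted degree `m`. -/
def spanMonomials (a : Fin s → R) (d : Fin s → ℕ) (m : ℕ) : Ideal R :=
  Submodule.span R ((fun β => ∏ i, a i ^ β i) '' {β : Fin s → ℕ | ∑ i, d i * β i = m})

variable {a : Fin s → R} {d : Fin s → ℕ}

theorem prod_pow_mem_spanMonomials (α : Fin s → ℕ) :
    ∏ i, a i ^ α i ∈ spanMonomials a d (∑ i, d i * α i) :=
  Submodule.subset_span ⟨α, rfl, rfl⟩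

theorem spanMonomials_zero : spanMonomials a d 0 = ⊤ := by
  rw [Ideal.eq_top_iff_one]
  simpa using prod_pow_mem_spanMonomials (a := a) (d := d) 0

theorem mem_spanMonomials_self (i : Fin s) : a i ∈ spanMonomials a d (d i) := by
  classical
  simpa [Pi.single_apply, pow_ite] using
    prod_pow_mem_spanMonomials (a := a) (d := d) (Pi.single i 1)

theorem spanMonomials_mul_le (j k : ℕ) :
    spanMonomials a d j * spanMonomials a d k ≤ spanMonomials a d (j + k) := by
  rw [spanMonomials, spanMonomials]
  refine (Ideal.span_mul_span' _ _).le.trans (Ideal.span_le.2 ?_)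
  rintro _ ⟨_, ⟨α, rfl, rfl⟩, _, ⟨β, rfl, rfl⟩, rfl⟩
  have := prod_pow_mem_spanMonomials (a := a) (d := d) (α + β)
  simp only [Pi.add_apply, pow_add, mul_add, Finset.prod_mul_distrib, Finset.sum_add_distrib]
    at this
  exact this

theorem prod_pow_mem_of_mul_le {N : ℕ → Ideal R} (h0 : N 0 = ⊤)
    (hN : ∀ j k, N j * N k ≤ N (j + k)) (ha : ∀ i, a i ∈ N (d i)) (α : Fin s → ℕ) :
    ∏ i, a i ^ α i ∈ N (∑ i, d i * α i) := by
  have hpow (i : Fin s) (k : ℕ) : a i ^ k ∈ N (d i * k) := by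
    induction k with
    | zero => rw [mul_zero, h0]; trivial
    | succ k ih => exact pow_succ (a i) k ▸ hN _ _ (Ideal.mul_mem_mul ih (ha i))
  classical
  induction (Finset.univ : Finset (Fin s)) using Finset.induction_on with
  | empty => rw [Finset.sum_empty, h0]; trivial
  | insert i T hi ih =>
    rw [Finset.prod_insert hi, Finset.sum_insert hi]
    exact hN _ _ (Ideal.mul_mem_mul (hpow i _) ih)

theorem spanMonomials_le {N : ℕ → Ideal R} (h0 : N 0 = ⊤)
    (hN : ∀ j k, N j * N k ≤ N (j + k)) (ha : ∀ i, a i ∈ N (d i)) (m : ℕ) :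
    spanMonomials a d m ≤ N m := by
  refine Submodule.span_le.2 ?_
  rintro _ ⟨α, rfl, rfl⟩
  exact prod_pow_mem_of_mul_le h0 hN ha α

theorem span_range_pow_eq_spanMonomials (b : Fin s → R) (m : ℕ) :
    Ideal.span (Set.range b) ^ m = spanMonomials b (fun _ => 1) m := by
  refine le_antisymm ?_ (spanMonomials_le (N := fun m => Ideal.span (Set.range b) ^ m)
    (by simp) (fun j k => (pow_add _ j k).ge)
    (fun i => by simpa using Ideal.subset_span (Set.mem_range_self i)) m)
  induction m with
  | zero => rw [spanMonomials_zero]; exact le_top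
  | succ m ih =>
    rw [pow_succ]
    refine (Ideal.mul_mono ih (Ideal.span_le.2 ?_)).trans (spanMonomials_mul_le m 1)
    rintro _ ⟨i, rfl⟩
    exact mem_spanMonomials_self (d := fun _ => 1) i

end SpanMonomials

/-! ### The symbolic Rees algebra -/

section SymbolicRees

variable {R : Type*} [CommRing R] {I : Ideal R}

theorem Ideal.symbolicPower_zero (I : Ideal R) : I.symbolicPower 0 = ⊤ :=
  top_le_iff.1 (by simpa using I.pow_le_symbolicPower 0)

theorem Ideal.symbolicPower_mul_le (I : Ideal R) (j k : ℕ) :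
    I.symbolicPower j * I.symbolicPower k ≤ I.symbolicPower (j + k) :=
  Ideal.mul_le.2 fun _ hx _ hy => Ideal.mul_mem_symbolicPower_add hx hy

theorem monomial_mem_symbolicReesAlgebra {m : ℕ} {x : R} (hx : x ∈ I.symbolicPower m) :
    monomial m x ∈ symbolicReesAlgebra I := fun i => by
  rw [coeff_monomial]
  split_ifs with h
  · exact h ▸ hx
  · exact zero_mem _

theorem symbolicPower_eq_spanMonomials_of_adjoin_eq_top {s : ℕ} {d : Fin s → ℕ} {a : Fin s → R}
    {g : Fin s → symbolicReesAlgebra I} (hg : ∀ i, (g i : R[X]) = monomial (d i) (a i))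
    (h : Algebra.adjoin R (Set.range g) = ⊤) (m : ℕ) :
    I.symbolicPower m = spanMonomials a d m := by
  apply le_antisymm
  · have key (f : symbolicReesAlgebra I) : ∀ m, (f : R[X]).coeff m ∈ spanMonomials a d m := by
      have hf : f ∈ Algebra.adjoin R (Set.range g) := h ▸ Algebra.mem_top
      induction hf using Algebra.adjoin_induction with
      | mem f hf =>
        obtain ⟨i, rfl⟩ := hf
        intro m
        rw [hg, coeff_monomial]
        split_ifs with h
        · exact h ▸ mem_spanMonomials_self i
        · exact zero_mem _
      | algebraMap r =>
        intro m
        rw [Subalgebra.coe_algebraMap, Polynomial.algebraMap_apply, coeff_C]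
        split_ifs with h
        · rw [h, spanMonomials_zero]; trivial
        · exact zero_mem _
      | add f g _ _ hf hg =>
        intro m
        rw [Subalgebra.coe_add, coeff_add]
        exact add_mem (hf m) (hg m)
      | mul f g _ _ hf hg =>
        intro m
        rw [Subalgebra.coe_mul, coeff_mul]
        refine sum_mem fun p hp => ?_
        rw [← Finset.HasAntidiagonal.mem_antidiagonal.1 hp]
        exact spanMonomials_mul_le _ _ (Ideal.mul_mem_mul (hf _) (hg _))
    intro x hx
    simpa using key ⟨_, monomial_mem_symbolicReesAlgebra hx⟩ m
  · refine spanMonomials_le I.symbolicPower_zero I.symbolicPower_mul_le (fun i => ?_) m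
    have := (g i).2 (d i)
    rwa [hg, coeff_monomial_same] at this

/-- A Noetherian symbolic Rees algebra is generated by finitely many homogeneous elements of
positive degree: take generators of the ideal of elements of positive degree. -/
theorem exists_symbolicPower_eq_spanMonomials (hI : IsNoetherianRing (symbolicReesAlgebra I)) :
    ∃ (s : ℕ) (d : Fin s → ℕ) (a : Fin s → R), (∀ i, 0 < d i) ∧
      ∀ m, I.symbolicPower m = spanMonomials a d m := by
  let S : Set (symbolicReesAlgebra I) := {f | ∃ k x, 0 < k ∧ (f : R[X]) = monomial k x}
  obtain ⟨T, hTS, hT⟩ := (Submodule.fg_span_iff_fg_span_finset_subset S).1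
    (IsNoetherian.noetherian (Ideal.span S))
  have hg (i : Fin T.card) := hTS (T.equivFin.symm i).2
  choose d a hd hg using hg
  refine ⟨T.card, d, a, hd, fun m => le_antisymm ?_ (spanMonomials_le I.symbolicPower_zero
    I.symbolicPower_mul_le (fun i => ?_) m)⟩
  · induction m using Nat.strong_induction_on with
    | h m ih =>
    rcases Nat.eq_zero_or_pos m with rfl | hm
    · rw [spanMonomials_zero]; exact le_top
    intro x hx
    have hmem : (⟨_, monomial_mem_symbolicReesAlgebra hx⟩ : symbolicReesAlgebra I) ∈
        Submodule.span (symbolicReesAlgebra I)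
          (Set.range fun i => (T.equivFin.symm i : symbolicReesAlgebra I)) := by
      have hr : (Set.range fun i => (T.equivFin.symm i : symbolicReesAlgebra I)) = T := by
        ext f
        exact ⟨by rintro ⟨i, rfl⟩; exact (T.equivFin.symm i).2,
          fun hf => ⟨T.equivFin ⟨f, hf⟩, by simp⟩⟩
      rw [hr, ← hT]
      exact Submodule.subset_span ⟨m, x, hm, rfl⟩
    -- Comparing coefficients of degree `m` writes `x` as a combination of the `a i` with
    -- coefficients in symbolic powers of smaller exponent, as `0 < d i`.
    obtain ⟨c, hc⟩ := (Submodule.mem_span_range_iff_exists_fun _).1 hmem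
    have hc := congrArg (fun f : symbolicReesAlgebra I => (f : R[X]).coeff m) hc
    simp only [smul_eq_mul, AddSubmonoidClass.coe_finsetSum, Subalgebra.coe_mul, hg,
      finsetSum_coeff, coeff_monomial_same] at hc
    rw [← hc]
    refine sum_mem fun i _ => ?_
    rw [← C_mul_X_pow_eq_monomial, ← mul_assoc, coeff_mul_X_pow']
    split_ifs with hi
    · have hlt : m - d i < m := Nat.sub_lt hm (hd i)
      have := spanMonomials_mul_le _ _ (Ideal.mul_mem_mul (ih _ hlt ((c i).2 (m - d i)))
        (mem_spanMonomials_self (a := a) (d := d) i))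
      rwa [Nat.sub_add_cancel hi, ← coeff_mul_C] at this
    · exact zero_mem _
  · have := (T.equivFin.symm i : symbolicReesAlgebra I).2 (d i)
    rwa [hg, coeff_monomial_same] at this

theorem Finset.univ_lcm_pos {s : ℕ} {d : Fin s → ℕ} (hd : ∀ i, 0 < d i) :
    0 < Finset.univ.lcm d :=
  Nat.pos_of_ne_zero fun h => by
    obtain ⟨i, -, hi⟩ := Finset.lcm_eq_zero_iff.1 h
    exact (hd i).ne' hi

/-- Nakayama's lemma expresses the symbolic defect as a difference of two lengths, each of which
counts the points of given weighted degree in a lower set. -/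
theorem eventuallyQuasiPolynomial_symbolicDefect [IsNoetherianRing R] {𝔪 : Ideal R}
    (h𝔪 : 𝔪.IsMaximal)
    (hdef : ∀ m, (symbolicDefect I m : ℕ∞) =
      (I ^ m ⊔ 𝔪 • I.symbolicPower m).relLength (I.symbolicPower m))
    {s : ℕ} {d : Fin s → ℕ} {a : Fin s → R} (hd : ∀ i, 0 < d i)
    (ha : ∀ m, I.symbolicPower m = spanMonomials a d m) :
    EventuallyQuasiPolynomial (fun m => (symbolicDefect I m : ℚ)) (Finset.univ.lcm d) := by
  obtain ⟨t, b, hb⟩ := Submodule.fg_iff_exists_fin_generating_family.1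
    (IsNoetherian.noetherian I)
  have hb (m : ℕ) : I ^ m = spanMonomials b (fun _ => 1) m := by
    rw [← span_range_pow_eq_spanMonomials, ← hb]
  let F (m : ℕ) : Ideal R := 𝔪 • I.symbolicPower m
  have hF {k : ℕ} {d : Fin k → ℕ} {a : Fin k → R}
      (ha : ∀ α : Fin k → ℕ, ∏ i, a i ^ α i ∈ I.symbolicPower (∑ i, d i * α i))
      (α : Fin k → ℕ) (m : ℕ) : ∀ x ∈ F m, (∏ i, a i ^ α i) * x ∈ F (∑ i, d i * α i + m) := by
    intro x hx
    have h : I.symbolicPower (∑ i, d i * α i) * F m ≤ F (∑ i, d i * α i + m) := by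
      change _ * (𝔪 * _) ≤ 𝔪 * _
      rw [mul_left_comm]
      exact Ideal.mul_mono_right (I.symbolicPower_mul_le _ _)
    exact h (Ideal.mul_mem_mul (ha α) hx)
  have hmon_a (α : Fin s → ℕ) : ∏ i, a i ^ α i ∈ I.symbolicPower (∑ i, d i * α i) :=
    ha _ ▸ prod_pow_mem_spanMonomials α
  have hmon_b (α : Fin t → ℕ) : ∏ i, b i ^ α i ∈ I.symbolicPower (∑ i, 1 * α i) :=
    I.pow_le_symbolicPower _ (hb _ ▸ prod_pow_mem_spanMonomials (d := fun _ => 1) α)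
  let A : LowerSet (Fin s → ℕ) := ⟨_, isLowerSet_standardExponents (hF hmon_a)⟩
  let B : LowerSet (Fin t → ℕ) := ⟨_, isLowerSet_standardExponents (d := fun _ => 1) (hF hmon_b)⟩
  have hn : 0 < Finset.univ.lcm d := Finset.univ_lcm_pos hd
  refine ((A.eventuallyQuasiPolynomial_ncard hd hn fun i =>
    Finset.dvd_lcm (Finset.mem_univ i)).sub (B.eventuallyQuasiPolynomial_ncard
      (fun _ => one_pos) hn fun i => one_dvd _)).congr fun m => ?_
  have hA := relLength_span_monomials_eq_ncard (F := F) h𝔪 hd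
    (fun α r hr => Ideal.mul_mem_mul hr (hmon_a α)) m
  have hB := relLength_span_monomials_eq_ncard (F := F) h𝔪 (fun _ => one_pos)
    (fun α r hr => Ideal.mul_mem_mul hr (hmon_b α)) m
  have hFN : F m ≤ I.symbolicPower m := Submodule.smul_le_right
  rw [← spanMonomials, ← ha, sup_eq_right.2 hFN, Submodule.relLength_add (B := F m ⊔ I ^ m)
    le_sup_left (sup_le hFN (I.pow_le_symbolicPower m))] at hA
  rw [← spanMonomials, ← hb] at hB
  rw [hB, sup_comm, ← hdef] at hA
  have hA : _ + _ = _ := Nat.cast_injective (R := ℕ∞) (by exact_mod_cast hA)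
  rw [eq_sub_iff_add_eq', ← Nat.cast_add]
  exact congrArg Nat.cast hA

end SymbolicRees

theorem theorem2p2 {R : Type*} [CommRing R] [IsNoetherianRing R] (I : Ideal R)
    (hR : IsLocalRing R ∨
      ∃ (𝒜 : ℤ → AddSubgroup R) (_ : GradedRing 𝒜), IsGradedLocal 𝒜 ∧ I.IsHomogeneous 𝒜)
    (hI : IsNoetherianRing (symbolicReesAlgebra I)) :
    ∃ Q : ℕ → ℚ, IsQuasiPolynomial Q ∧
      (∀ᶠ m : ℕ in Filter.atTop, (symbolicDefect I m : ℚ) = Q m) ∧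
      ∀ (s : ℕ) (d : Fin s → ℕ) (g : Fin s → symbolicReesAlgebra I),
        (∀ i, 0 < d i) →
        (∀ i, ∃ a : R, (g i : R[X]) = monomial (d i) a) →
        Algebra.adjoin R (Set.range g) = ⊤ →
        HasQuasiPeriod Q (Finset.univ.lcm d) := by
  obtain ⟨𝔪, h𝔪, hdef⟩ := exists_isMaximal_symbolicDefect_eq_relLength I hR
  have main {s : ℕ} {d : Fin s → ℕ} {a : Fin s → R} (hd : ∀ i, 0 < d i)
      (ha : ∀ m, I.symbolicPower m = spanMonomials a d m) :
      ∃ Q : ℕ → ℚ, HasQuasiPeriod Q (Finset.univ.lcm d) ∧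
        ∀ᶠ m in Filter.atTop, (symbolicDefect I m : ℚ) = Q m :=
    (eventuallyQuasiPolynomial_symbolicDefect h𝔪 hdef hd ha).exists_hasQuasiPeriod
      (Finset.univ_lcm_pos hd)
  obtain ⟨s, d, a, hd, ha⟩ := exists_symbolicPower_eq_spanMonomials hI
  obtain ⟨Q, hQ, hQm⟩ := main hd ha
  refine ⟨Q, ⟨_, hQ⟩, hQm, fun s' d' g hd' hg hadj => ?_⟩
  choose a' hg using hg
  obtain ⟨Q', hQ', hQm'⟩ := main hd' (symbolicPower_eq_spanMonomials_of_adjoin_eq_top hg hadj)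
  rw [hQ.eq_of_eventuallyEq hQ' (hQm.mp (hQm'.mono fun m h h' => h'.symm.trans h))]
  exact hQ'
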